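/- Let $f\colon\mathbb R^n\to\mathbb R$ and $F\colon\mathbb R^n\to\mathbb R^m$ be twice continuously differentiable, let $D_1,\dots,D_r\subset\mathbb R^m$ be polyhedral sets (each an intersection of finitely many closed half-spaces), $D:=\bigcup_{i=1}^r D_i$, and consider the mathematical program with disjunctive constraints $$\min f(x)\quad\text{subject to}\quad F(x)\in D,\tag{MPDC}$$ with feasible set $X:=\{x\in\mathbb R^n: F(x)\in D\}$. For $A\subset\mathbb R^m$ and $y\in A$ let $$\mathcal T_A(y):=\{v:\ \exists\, t_k>0,\ t_k\to0,\ v_k\to v\ \text{with}\ y+t_kv_k\in A\ \text{for all } k\}$$ be the (Bouligand) tangent cone and $\widehat{\mathcal N}_A(y):=\{\eta:\ \eta\cdot v\le 0\ \text{for all } v\in\mathcal T_A(y)\}$ the Fréchet normal cone. For $\bar x\in X$ put $I(\bar x):=\{i: F(\bar x)\in D_i\}$, let $$L(x,\lambda):=f(x)+F(x)\cdot\lambda$$ be the Lagrangian, and let $$S(\bar x):=\Big\{\lambda\in\bigcap_{i\in I(\bar x)}\widehat{\mathcal N}_{D_i}(F(\bar x)):\ \nabla_xL(\bar x,\lambda)=0\Big\}$$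 be the set of multipliers solving the S-stationarity (strong stationarity) system at $\bar x$. Let $$\mathcal L_X(\bar x):=\{d\in\mathbb R^n:\nabla F(\bar x)d\in\mathcal T_D(F(\bar x))\},\qquad \mathcal C_X(\bar x):=\{d\in\mathcal L_X(\bar x):\nabla f(\bar x)\cdot d\le0\}$$ be the linearization cone and the critical cone. MPDC-LICQ is said to hold at $\bar x$ if $$\nabla F(\bar x)^\top\lambda=0,\quad \lambda\in\sum_{i\in I(\bar x)}\operatorname{span}\widehat{\mathcal N}_{D_i}(F(\bar x))\quad\Longrightarrow\quad\lambda=0.$$ **Theorem.** Let $\bar x\in X$ be a local minimizer of (MPDC) at which MPDC-LICQ holds. Then $S(\bar x)$ consists of exactly one multiplier $\bar\lambda$, and $$d^\top\nabla^2_{xx}L(\bar x,\bar\lambda)\,d\ \ge\ 0\qquad\text{for all } d\in\mathcal C_X(\bar x).$$ -/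

import Mathlib

open Filter Topology

noncomputable section

namespace Disjunctive

/-- `ℝⁿ` with the Euclidean inner product and norm. -/
abbrev Eucl (n : ℕ) : Type := EuclideanSpace ℝ (Fin n)

/-- A set is polyhedral if it is the intersection of finitely many closed half spaces
`{y | a · y ≤ b}`. -/
def IsPolyhedral {n : ℕ} (Q : Set (Eucl n)) : Prop :=
  ∃ (N : ℕ) (a : Fin N → Eucl n) (b : Fin N → ℝ), Q = {y | ∀ j, inner ℝ (a j) y ≤ b j}

/-- The (Bouligand) tangent cone to `A` at `x`; it is empty if `x ∉ A`. -/
def tangentCone {n : ℕ} (A : Set (Eucl n)) (x : Eucl n) : Set (Eucl n) :=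
  {d | x ∈ A ∧ ∃ (t : ℕ → ℝ) (e : ℕ → Eucl n),
    (∀ k, 0 < t k) ∧ Tendsto t atTop (𝓝 0) ∧ Tendsto e atTop (𝓝 d) ∧
      ∀ k, x + t k • e k ∈ A}

/-- The polar cone of a set. -/
def polarCone {n : ℕ} (A : Set (Eucl n)) : Set (Eucl n) :=
  {y | ∀ x ∈ A, inner ℝ x y ≤ 0}

/-- The Fréchet (regular) normal cone to `A` at `x`: the polar of the tangent cone if `x ∈ A`,
and empty if `x ∉ A`. -/
def frechetNormalCone {n : ℕ} (A : Set (Eucl n)) (x : Eucl n) : Set (Eucl n) :=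
  {y | x ∈ A ∧ y ∈ polarCone (tangentCone A x)}

/-- The Hessian of `φ` at `x` as a bilinear form: `hessian φ x d h = dᵀ ∇²φ(x) h`. -/
def hessian {n : ℕ} (φ : Eucl n → ℝ) (x : Eucl n) : Eucl n →L[ℝ] Eucl n →L[ℝ] ℝ :=
  fderiv ℝ (fderiv ℝ φ) x

/-- A mathematical program with disjunctive constraints: minimize `f x` subject to
`F x ∈ D₁ ∪ ⋯ ∪ Dᵣ`, where `f : ℝⁿ → ℝ` and `F : ℝⁿ → ℝᵐ` are twice continuously differentiable
and `D₁, …, Dᵣ ⊆ ℝᵐ` are polyhedral. -/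
structure MPDC (n m r : ℕ) where
  f : Eucl n → ℝ
  F : Eucl n → Eucl m
  D : Fin r → Set (Eucl m)
  contDiff_f : ContDiff ℝ 2 f
  contDiff_F : ContDiff ℝ 2 F
  polyhedral_D : ∀ i, IsPolyhedral (D i)

namespace MPDC

variable {n m r : ℕ} (P : MPDC n m r)

/-- The union `D` of the sets `Dᵢ`. -/
def disjunctiveSet : Set (Eucl m) := ⋃ i, P.D i

/-- The feasible set `X`. -/
def feasibleSet : Set (Eucl n) := {x | P.F x ∈ P.disjunctiveSet}

/-- `x` is a locally optimal solution (local minimizer). -/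
def IsLocallyOptimal (x : Eucl n) : Prop :=
  x ∈ P.feasibleSet ∧ IsLocalMinOn P.f P.feasibleSet x

/-- The index set `I(x)` of those `i` with `F x ∈ Dᵢ`. -/
def activeIndices (x : Eucl n) : Set (Fin r) := {i | P.F x ∈ P.D i}

/-- The Jacobian `∇F(x)`, as a linear map. -/
def jacobian (x : Eucl n) : Eucl n →L[ℝ] Eucl m := fderiv ℝ P.F x

/-- MPDC-LICQ at `x`: the only `lam` in the sum, over `i ∈ I(x)`, of the spans of the Fréchet
normal cones to `Dᵢ` at `F x` with `∇F(x)ᵀ lam = 0` is `lam = 0`. -/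
def LICQ (x : Eucl n) : Prop :=
  ∀ lam : Eucl m, ContinuousLinearMap.adjoint (P.jacobian x) lam = 0 →
    lam ∈ (⨆ i ∈ P.activeIndices x,
      Submodule.span ℝ (frechetNormalCone (P.D i) (P.F x)) : Submodule ℝ (Eucl m)) →
    lam = 0

/-- The Lagrangian `L(x, lam) = f(x) + F(x) · lam`. -/
def lagrangian (x : Eucl n) (lam : Eucl m) : ℝ := P.f x + inner ℝ (P.F x) lam

/-- The set `S(x)` of multipliers that solve the system of strong stationarity at `x`. -/
def multipliers (x : Eucl n) : Set (Eucl m) :=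
  {lam | lam ∈ (⋂ i ∈ P.activeIndices x, frechetNormalCone (P.D i) (P.F x)) ∧
    gradient (fun z => P.lagrangian z lam) x = 0}

/-- The linearization cone to `X` at `x`. -/
def linearizationCone (x : Eucl n) : Set (Eucl n) :=
  {d | P.jacobian x d ∈ tangentCone P.disjunctiveSet (P.F x)}

/-- The critical cone to `X` at `x`. -/
def criticalCone (x : Eucl n) : Set (Eucl n) :=
  {d | d ∈ P.linearizationCone x ∧ inner ℝ (gradient P.f x) d ≤ 0}

end MPDC

end Disjunctive

end

/-! Write `A` for the Jacobian at the minimizer and `W` for `normalSpan`. LICQ says that `Aᵀ` is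
injective on `W`, so `A` has a right inverse `C` modulo `Wᗮ`
(`exists_rightInverse_modulo_orthogonal`). Near `F x`, membership in an active polyhedron is decided
by the `W`-component alone. An inverse function argument therefore turns every `d` with `A d`
tangent to an active polyhedron into the velocity of a feasible curve along which `F` is exactly
affine modulo `Wᗮ` (`exists_feasible_curve`). To first order, `f` does not decrease in these
directions, which makes `-Cᵀ∇f` a multiplier. To second order, a critical `d` satisfies `⟪lam, A d⟫
= 0`, so the constraint term of the Lagrangian is constant along the curve and the Lagrangian
inherits minimality from `f`. Since its gradient vanishes, the curve's acceleration plays no role.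
-/

namespace Disjunctive

/-! ### Necessary conditions along curves, and curves with prescribed velocity. -/

section Curves

variable {E : Type*} [NormedAddCommGroup E] [NormedSpace ℝ E]

/-- Second-order Taylor estimate at a critical point. -/
theorem eventually_norm_sub_half_hessian_le {φ : E → ℝ} {x : E} (hφ : ContDiff ℝ 2 φ)
    (hx : fderiv ℝ φ x = 0) {ε : ℝ} (hε : 0 < ε) :
    ∀ᶠ z in 𝓝 x, ‖φ z - φ x - (1 / 2) * fderiv ℝ (fderiv ℝ φ) x (z - x) (z - x)‖
      ≤ ε * ‖z - x‖ ^ 2 := by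
  set H := fderiv ℝ (fderiv ℝ φ) x
  have hsymm : ∀ u v, H u v = H v u := by
    have h : IsSymmSndFDerivAt ℝ φ x := hφ.contDiffAt.isSymmSndFDerivAt (by simp)
    exact fun u v => h.eq u v
  have hdiff : Differentiable ℝ φ := hφ.differentiable (by norm_num)
  have hd2 : HasFDerivAt (fderiv ℝ φ) H x :=
    ((hφ.fderiv_right (m := 1) (by norm_num)).differentiable (by norm_num) x).hasFDerivAt
  have hr : ∀ z, HasFDerivAt (fun z => φ z - (1 / 2) * H (z - x) (z - x))
      (fderiv ℝ φ z - H (z - x)) z := by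
    intro z
    have h1 : HasFDerivAt (fun z : E => z - x) (ContinuousLinearMap.id ℝ E) z :=
      (hasFDerivAt_id z).sub_const x
    have h2 := H.hasFDerivAt_of_bilinear h1 h1
    refine ((hdiff z).hasFDerivAt.sub (h2.const_mul (1 / 2))).congr_fderiv ?_
    ext u
    have h3 := hsymm u (z - x)
    simp at h3 ⊢
    linarith
  have ho := (hasFDerivAt_iff_isLittleO.1 hd2).def hε
  obtain ⟨δ, hδ, hball⟩ := Metric.eventually_nhds_iff.1 ho
  refine Metric.eventually_nhds_iff.2 ⟨δ, hδ, fun z hz => ?_⟩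
  -- Mean value inequality for `φ` minus its quadratic model, on the ball of radius `‖z - x‖`, where
  -- the derivative is at most `ε * ‖z - x‖`.
  have hmv := (convex_closedBall x ‖z - x‖).norm_image_sub_le_of_norm_hasFDerivWithin_le
    (f := fun z => φ z - (1 / 2) * H (z - x) (z - x)) (C := ε * ‖z - x‖)
    (x := x) (y := z) (fun u _ => (hr u).hasFDerivWithinAt) (fun u hu => ?_)
    (by simp) (by simp [dist_eq_norm])
  · simp only [sub_self, map_zero, mul_zero, sub_zero] at hmv
    calc _ = ‖φ z - (1 / 2) * H (z - x) (z - x) - φ x‖ := by congr 1; ring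
      _ ≤ _ := hmv
      _ = _ := by ring
  · have hu' : ‖u - x‖ ≤ ‖z - x‖ := by simpa [dist_eq_norm] using hu
    have h := hball (y := u) (by rw [dist_eq_norm] at hz ⊢; exact hu'.trans_lt hz)
    rw [hx, sub_zero] at h
    exact h.trans (by gcongr)

theorem tendsto_slope_of_hasDerivAt {c : ℝ → E} {d : E} (hc : HasDerivAt c d 0) :
    Tendsto (fun t : ℝ => t⁻¹ • (c t - c 0)) (𝓝[>] 0) (𝓝 d) := by
  have h := hasDerivAt_iff_tendsto_slope.1 hc
  refine (h.mono_left (nhdsWithin_mono _ fun t ht => ne_of_gt ht)).congr fun t => ?_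
  simp [slope_def_module]

theorem fderiv_apply_nonneg_of_curve {φ : E → ℝ} {c : ℝ → E} {d : E}
    (hφ : DifferentiableAt ℝ φ (c 0)) (hc : HasDerivAt c d 0)
    (hmin : ∀ᶠ t in 𝓝[>] (0 : ℝ), φ (c 0) ≤ φ (c t)) :
    0 ≤ fderiv ℝ φ (c 0) d := by
  have h := hφ.hasFDerivAt.comp_hasDerivAt (0 : ℝ) hc
  refine ge_of_tendsto (tendsto_slope_of_hasDerivAt h) ?_
  filter_upwards [hmin, self_mem_nhdsWithin] with t ht ht0
  exact mul_nonneg (inv_nonneg.2 (le_of_lt ht0)) (sub_nonneg.2 ht)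

/-- With no first-order term, dividing the Taylor estimate by `t²` leaves only the difference
quotient of `c`, so one derivative of `c` at `0` suffices. -/
theorem hessian_apply_nonneg_of_curve {φ : E → ℝ} {c : ℝ → E} {d : E}
    (hφ : ContDiff ℝ 2 φ) (hcrit : fderiv ℝ φ (c 0) = 0) (hc : HasDerivAt c d 0)
    (hmin : ∀ᶠ t in 𝓝[>] (0 : ℝ), φ (c 0) ≤ φ (c t)) :
    0 ≤ fderiv ℝ (fderiv ℝ φ) (c 0) d d := by
  set H := fderiv ℝ (fderiv ℝ φ) (c 0)
  have hq := tendsto_slope_of_hasDerivAt hc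
  have key : ∀ ε > 0, 0 ≤ (1 / 2) * H d d + ε * ‖d‖ ^ 2 := by
    intro ε hε
    have hlim : Tendsto (fun t : ℝ => (1 / 2) * H (t⁻¹ • (c t - c 0)) (t⁻¹ • (c t - c 0))
        + ε * ‖t⁻¹ • (c t - c 0)‖ ^ 2) (𝓝[>] 0) (𝓝 ((1 / 2) * H d d + ε * ‖d‖ ^ 2)) := by
      have hcont : Continuous fun v : E => (1 / 2) * H v v + ε * ‖v‖ ^ 2 := by fun_prop
      exact (hcont.tendsto d).comp hq
    refine ge_of_tendsto hlim ?_
    have hT := (hc.continuousAt.mono_left nhdsWithin_le_nhds :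
      Tendsto c (𝓝[>] 0) (𝓝 (c 0))).eventually (eventually_norm_sub_half_hessian_le hφ hcrit hε)
    filter_upwards [hmin, hT, self_mem_nhdsWithin] with t ht hTt ht0
    have ht0' : (0 : ℝ) < t := ht0
    have h1 := (abs_le.1 (Real.norm_eq_abs _ ▸ hTt)).2
    have h2 : 0 ≤ (1 / 2) * H (c t - c 0) (c t - c 0) + ε * ‖c t - c 0‖ ^ 2 := by linarith
    have h3 : (1 / 2) * H (t⁻¹ • (c t - c 0)) (t⁻¹ • (c t - c 0))
        + ε * ‖t⁻¹ • (c t - c 0)‖ ^ 2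
        = (t⁻¹) ^ 2 * ((1 / 2) * H (c t - c 0) (c t - c 0) + ε * ‖c t - c 0‖ ^ 2) := by
      simp only [map_smul, smul_apply, smul_eq_mul, norm_smul, mul_pow,
        Real.norm_eq_abs, sq_abs]
      ring
    rw [h3]
    positivity
  have hlim : Tendsto (fun ε : ℝ => (1 / 2) * H d d + ε * ‖d‖ ^ 2) (𝓝[>] 0)
      (𝓝 ((1 / 2) * H d d + 0 * ‖d‖ ^ 2)) :=
    (Continuous.tendsto (by fun_prop) 0).mono_left nhdsWithin_le_nhds
  have := ge_of_tendsto hlim (by filter_upwards [self_mem_nhdsWithin] with ε hε using key ε hε)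
  linarith

/-- For a linear map `C`, there is a curve with velocity `d` that solves
`c t + C (G (c t) - G x - G' (c t - x)) = x + t d`. -/
theorem exists_curve_of_correction [CompleteSpace E] {V : Type*} [NormedAddCommGroup V]
    [NormedSpace ℝ V] {G : E → V} {G' : E →L[ℝ] V} {x : E} (hG : HasStrictFDerivAt G G' x)
    (C : V →L[ℝ] E) (d : E) :
    ∃ c : ℝ → E, c 0 = x ∧ HasDerivAt c d 0 ∧
      ∀ᶠ t in 𝓝 (0 : ℝ), c t + C (G (c t) - G x - G' (c t - x)) = x + t • d := by
  -- The correction vanishes to first order at `x`, so `Ψ` has derivative the identity there and is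
  -- locally invertible.
  set Ψ : E → E := fun z => z + C (G z - G x - G' (z - x)) with hΨ
  have hx : Ψ x = x := by simp [hΨ]
  have hΨ' : HasStrictFDerivAt Ψ ((ContinuousLinearEquiv.refl ℝ E : E ≃L[ℝ] E) : E →L[ℝ] E) x := by
    have h1 : HasStrictFDerivAt (fun z : E => z - x) (ContinuousLinearMap.id ℝ E) x :=
      (hasStrictFDerivAt_id x).sub_const x
    have h2 := (hasStrictFDerivAt_id x).add
      (C.hasStrictFDerivAt.comp x ((hG.sub_const (G x)).sub (G'.hasStrictFDerivAt.comp x h1)))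
    refine h2.congr_fderiv ?_
    ext u
    simp
  have hline : HasDerivAt (fun t : ℝ => x + t • d) d 0 := by
    simpa using ((hasDerivAt_id (0 : ℝ)).smul_const d).const_add x
  have hlim : Tendsto (fun t : ℝ => x + t • d) (𝓝 0) (𝓝 (Ψ x)) := by
    have := hline.continuousAt.tendsto
    simpa [hx] using this
  refine ⟨fun t => hΨ'.localInverse Ψ _ x (x + t • d), ?_, ?_, hlim.eventually
    hΨ'.eventually_right_inverse⟩
  · have := hΨ'.localInverse_apply_image
    rw [hx] at this
    simpa using this
  · have h := hΨ'.to_localInverse.hasFDerivAt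
    have h' : HasFDerivAt (hΨ'.localInverse Ψ _ x)
        (((ContinuousLinearEquiv.refl ℝ E).symm : E ≃L[ℝ] E) : E →L[ℝ] E)
        (x + (0 : ℝ) • d) := by simpa [hx] using h
    simpa [Function.comp_def] using h'.comp_hasDerivAt (0 : ℝ) hline

end Curves

/-! ### Tangent and normal cones of polyhedra and their unions. -/

section Polyhedra

variable {m : ℕ}

/-- A direction approximated by points of a polyhedron for infinitely many terms of the sequence
satisfies all active linear constraints. -/
theorem inner_nonpos_of_frequently_mem {N : ℕ} {a : Fin N → Eucl m} {b : Fin N → ℝ} {y v : Eucl m}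
    {t : ℕ → ℝ} {e : ℕ → Eucl m} (ht : ∀ k, 0 < t k) (he : Tendsto e atTop (𝓝 v))
    (h : ∃ᶠ k in atTop, y + t k • e k ∈ {z | ∀ j, inner ℝ (a j) z ≤ b j})
    {j : Fin N} (hj : inner ℝ (a j) y = b j) : inner ℝ (a j) v ≤ 0 := by
  have hcl : IsClosed {z : Eucl m | inner ℝ (a j) z ≤ 0} :=
    isClosed_le (by fun_prop) continuous_const
  refine hcl.mem_of_frequently_of_tendsto (h.mono fun k hk => ?_) he
  have h1 := hk j
  rw [inner_add_right, inner_smul_right, hj] at h1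
  exact nonpos_of_mul_nonpos_right (by linarith) (ht k)

theorem isClosed_polyhedron {N : ℕ} (a : Fin N → Eucl m) (b : Fin N → ℝ) :
    IsClosed {z : Eucl m | ∀ j, inner ℝ (a j) z ≤ b j} := by
  simp only [Set.ofPred_forall]
  exact isClosed_iInter fun j => isClosed_le (by fun_prop) continuous_const

/-- Curves through a point of a polyhedron that do not increase the active constraints stay in the
polyhedron for a short time. -/
theorem eventually_mem_polyhedron {N : ℕ} {a : Fin N → Eucl m} {b : Fin N → ℝ} {y : Eucl m}
    (hy : y ∈ {z : Eucl m | ∀ j, inner ℝ (a j) z ≤ b j}) {α : Type*} {l : Filter α}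
    {c : α → Eucl m} (hc : Tendsto c l (𝓝 y))
    (h : ∀ j, inner ℝ (a j) y = b j → ∀ᶠ t in l, inner ℝ (a j) (c t - y) ≤ 0) :
    ∀ᶠ t in l, c t ∈ {z : Eucl m | ∀ j, inner ℝ (a j) z ≤ b j} := by
  refine eventually_all.2 fun j => ?_
  by_cases hj : inner ℝ (a j) y = b j
  · filter_upwards [h j hj] with t ht
    rw [inner_sub_right] at ht
    linarith
  · have hcont : Continuous fun z : Eucl m => inner ℝ (a j) z := by fun_prop
    filter_upwards [((hcont.tendsto y).comp hc).eventually_lt_const (lt_of_le_of_ne (hy j) hj)]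
      with t ht using le_of_lt ht

theorem mem_tangentCone_polyhedron_iff {N : ℕ} {a : Fin N → Eucl m} {b : Fin N → ℝ} {y v : Eucl m}
    (hy : y ∈ {z : Eucl m | ∀ j, inner ℝ (a j) z ≤ b j}) :
    v ∈ tangentCone {z : Eucl m | ∀ j, inner ℝ (a j) z ≤ b j} y ↔
      ∀ j, inner ℝ (a j) y = b j → inner ℝ (a j) v ≤ 0 := by
  constructor
  · rintro ⟨-, t, e, ht, -, he, hmem⟩ j hj
    exact inner_nonpos_of_frequently_mem ht he (Eventually.frequently (.of_forall hmem)) hj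
  · intro h
    have hline : Tendsto (fun t : ℝ => y + t • v) (𝓝[>] 0) (𝓝 y) := by
      have hcont : Continuous fun t : ℝ => y + t • v := by fun_prop
      simpa using (hcont.tendsto 0).mono_left nhdsWithin_le_nhds
    have hev := eventually_mem_polyhedron hy hline fun j hj => by
      filter_upwards [self_mem_nhdsWithin] with t ht
      rw [add_sub_cancel_left, inner_smul_right]
      exact mul_nonpos_of_nonneg_of_nonpos (le_of_lt ht) (h j hj)
    obtain ⟨u, hu, hmem⟩ := exists_seq_forall_of_frequently
      (hev.and self_mem_nhdsWithin).frequently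
    exact ⟨hy, u, fun _ => v, fun k => (hmem k).2, hu.mono_right nhdsWithin_le_nhds,
      tendsto_const_nhds, fun k => (hmem k).1⟩

theorem active_mem_frechetNormalCone {N : ℕ} {a : Fin N → Eucl m} {b : Fin N → ℝ} {y : Eucl m}
    (hy : y ∈ {z : Eucl m | ∀ j, inner ℝ (a j) z ≤ b j}) {j : Fin N}
    (hj : inner ℝ (a j) y = b j) :
    a j ∈ frechetNormalCone {z : Eucl m | ∀ j, inner ℝ (a j) z ≤ b j} y :=
  ⟨hy, fun v hv => by
    rw [real_inner_comm]
    exact (mem_tangentCone_polyhedron_iff hy).1 hv j hj⟩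

theorem IsPolyhedral.isClosed {Q : Set (Eucl m)} (hQ : IsPolyhedral Q) : IsClosed Q := by
  obtain ⟨N, a, b, rfl⟩ := hQ
  exact isClosed_polyhedron a b

/-- The tangent cone to a polyhedron depends only on the pairing with the normal cone. -/
theorem IsPolyhedral.mem_tangentCone_of_inner_eq {Q : Set (Eucl m)} (hQ : IsPolyhedral Q)
    {y u v : Eucl m} (hu : u ∈ tangentCone Q y)
    (h : ∀ w ∈ frechetNormalCone Q y, inner ℝ w v = inner ℝ w u) : v ∈ tangentCone Q y := by
  obtain ⟨N, a, b, rfl⟩ := hQ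
  have hy := hu.1
  refine (mem_tangentCone_polyhedron_iff hy).2 fun j hj => ?_
  rw [h _ (active_mem_frechetNormalCone hy hj)]
  exact (mem_tangentCone_polyhedron_iff hy).1 hu j hj

theorem IsPolyhedral.zero_mem_tangentCone {Q : Set (Eucl m)} (hQ : IsPolyhedral Q)
    {y : Eucl m} (hy : y ∈ Q) : 0 ∈ tangentCone Q y := by
  obtain ⟨N, a, b, rfl⟩ := hQ
  exact (mem_tangentCone_polyhedron_iff hy).2 fun j _ => by simp

/-- Active constraint vectors are normals, so active constraints do not increase along `c`; inactive
ones stay strict by continuity. -/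
theorem IsPolyhedral.eventually_mem {Q : Set (Eucl m)} (hQ : IsPolyhedral Q)
    {y v : Eucl m} (hv : v ∈ tangentCone Q y) {c : ℝ → Eucl m} (hc : Tendsto c (𝓝[>] 0) (𝓝 y))
    (h : ∀ᶠ t in 𝓝[>] (0 : ℝ), ∀ w ∈ frechetNormalCone Q y,
      inner ℝ w (c t - y) = t * inner ℝ w v) :
    ∀ᶠ t in 𝓝[>] (0 : ℝ), c t ∈ Q := by
  obtain ⟨N, a, b, rfl⟩ := hQ
  have hy := hv.1
  refine eventually_mem_polyhedron hy hc fun j hj => ?_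
  filter_upwards [h, self_mem_nhdsWithin] with t ht ht0
  rw [ht _ (active_mem_frechetNormalCone hy hj)]
  exact mul_nonpos_of_nonneg_of_nonpos (le_of_lt ht0)
    ((mem_tangentCone_polyhedron_iff hy).1 hv j hj)

theorem exists_mem_tangentCone_of_iUnion {r : ℕ} {D : Fin r → Set (Eucl m)}
    (hD : ∀ i, IsPolyhedral (D i)) {y v : Eucl m} (hv : v ∈ tangentCone (⋃ i, D i) y) :
    ∃ i, y ∈ D i ∧ v ∈ tangentCone (D i) y := by
  obtain ⟨-, t, e, ht, ht0, he, hmem⟩ := hv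
  -- Pigeonhole: finitely many sets share the sequence, so one is visited infinitely often.
  have hfreq : ∃ i, ∃ᶠ k in atTop, y + t k • e k ∈ D i := by
    by_contra! hcon
    have hall : ∀ᶠ k in atTop, ∀ i, y + t k • e k ∉ D i :=
      eventually_all.2 hcon
    obtain ⟨k, hk⟩ := hall.exists
    obtain ⟨i, hi⟩ := Set.mem_iUnion.1 (hmem k)
    exact hk i hi
  obtain ⟨i, hi⟩ := hfreq
  have hlim : Tendsto (fun k => y + t k • e k) atTop (𝓝 y) := by
    simpa using tendsto_const_nhds.add (ht0.smul he)
  have hy : y ∈ D i := (hD i).isClosed.mem_of_frequently_of_tendsto hi hlim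
  refine ⟨i, hy, ?_⟩
  obtain ⟨N, a, b, hQ⟩ := hD i
  rw [hQ] at hi hy ⊢
  exact (mem_tangentCone_polyhedron_iff hy).2 fun j hj =>
    inner_nonpos_of_frequently_mem ht he hi hj

end Polyhedra

/-- If `Aᵀ` is injective on the subspace `W`, then `A` can be inverted from the right modulo the
orthogonal complement of `W`. -/
theorem exists_rightInverse_modulo_orthogonal {n m : ℕ} (A : Eucl n →L[ℝ] Eucl m)
    (W : Submodule ℝ (Eucl m))
    (hinj : ∀ w ∈ W, ContinuousLinearMap.adjoint A w = 0 → w = 0) :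
    ∃ C : Eucl m →L[ℝ] Eucl n, (∀ w ∈ W, ∀ v, inner ℝ w (A (C v)) = inner ℝ w v) ∧
      ∀ g, ContinuousLinearMap.adjoint C g ∈ W := by
  set p : Eucl n →ₗ[ℝ] W := (W.orthogonalProjectionOnto.comp A).toLinearMap with hp
  have hsurj : LinearMap.range p = ⊤ := by
    rw [← Submodule.orthogonal_eq_bot_iff, Submodule.eq_bot_iff]
    intro w hw
    have hzero : ContinuousLinearMap.adjoint A (w : Eucl m) = 0 := by
      refine ext_inner_right ℝ fun d => ?_
      have h := (Submodule.mem_orthogonal' _ _).1 hw (p d) ⟨d, rfl⟩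
      rw [ContinuousLinearMap.adjoint_inner_left, inner_zero_left]
      simpa [hp] using h
    exact Subtype.ext (hinj w w.2 hzero)
  obtain ⟨s, hs⟩ := p.exists_rightInverse_of_surjective hsurj
  have hs' : ∀ w, p (s w) = w := fun w => LinearMap.congr_fun hs w
  refine ⟨s.toContinuousLinearMap.comp W.orthogonalProjectionOnto, fun w hw v => ?_, fun g => ?_⟩
  · have h := congrArg (fun u : W => inner ℝ (⟨w, hw⟩ : W) u) (hs' (W.orthogonalProjectionOnto v))
    simpa [hp] using h
  -- `C` factors through the projection onto `W`, so the range of its adjoint lies in `Wᗮᗮ = W`.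
  · suffices h : ∀ u ∈ Wᗮ, inner ℝ (ContinuousLinearMap.adjoint
        (s.toContinuousLinearMap.comp W.orthogonalProjectionOnto) g) u = 0 from
      W.orthogonal_orthogonal.le ((Submodule.mem_orthogonal' _ _).2 h)
    intro u hu
    rw [ContinuousLinearMap.adjoint_inner_left]
    have : W.orthogonalProjectionOnto u = 0 := by
      simpa using hu
    simp [this]

/-! ### Stationarity and second-order conditions under MPDC-LICQ. -/

namespace MPDC

variable {n m r : ℕ} (P : MPDC n m r)

/-- The sum of the spans of the normal cones to the active polyhedra. -/
def normalSpan (x : Eucl n) : Submodule ℝ (Eucl m) :=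
  ⨆ i ∈ P.activeIndices x, Submodule.span ℝ (frechetNormalCone (P.D i) (P.F x))

theorem mem_normalSpan {x : Eucl n} {i : Fin r} (hi : i ∈ P.activeIndices x) {w : Eucl m}
    (hw : w ∈ frechetNormalCone (P.D i) (P.F x)) : w ∈ P.normalSpan x :=
  le_iSup₂_of_le (f := fun i (_ : i ∈ P.activeIndices x) =>
    Submodule.span ℝ (frechetNormalCone (P.D i) (P.F x))) i hi le_rfl (Submodule.subset_span hw)

theorem hasStrictFDerivAt_F (x : Eucl n) : HasStrictFDerivAt P.F (P.jacobian x) x :=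
  P.contDiff_F.contDiffAt.hasStrictFDerivAt (by norm_num)

/-- Under MPDC-LICQ, every direction whose image is tangent to an active polyhedron is the velocity
of a feasible curve along which `F` is affine modulo the complement of `normalSpan`. -/
theorem exists_feasible_curve {x : Eucl n} (hlicq : P.LICQ x) {i : Fin r} {d : Eucl n}
    (hi : i ∈ P.activeIndices x) (hd : P.jacobian x d ∈ tangentCone (P.D i) (P.F x)) :
    ∃ c : ℝ → Eucl n, c 0 = x ∧ HasDerivAt c d 0 ∧
      (∀ᶠ t in 𝓝[>] (0 : ℝ), c t ∈ P.feasibleSet) ∧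
      ∀ᶠ t in 𝓝[>] (0 : ℝ), ∀ w ∈ P.normalSpan x,
        inner ℝ w (P.F (c t) - P.F x) = t * inner ℝ w (P.jacobian x d) := by
  obtain ⟨C, hC, -⟩ := exists_rightInverse_modulo_orthogonal (P.jacobian x) (P.normalSpan x)
    fun w hw h => hlicq w h hw
  obtain ⟨c, hc0, hc, heq⟩ := exists_curve_of_correction (P.hasStrictFDerivAt_F x) C d
  have hF : ∀ᶠ t in 𝓝[>] (0 : ℝ), ∀ w ∈ P.normalSpan x,
      inner ℝ w (P.F (c t) - P.F x) = t * inner ℝ w (P.jacobian x d) := by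
    filter_upwards [nhdsWithin_le_nhds heq] with t ht w hw
    have h1 := hC w hw (P.F (c t) - P.F x - P.jacobian x (c t - x))
    have h2 : C (P.F (c t) - P.F x - P.jacobian x (c t - x)) = t • d - (c t - x) := by
      rw [← sub_eq_iff_eq_add'.2 ht.symm]
      abel
    rw [h2, map_sub, map_smul, inner_sub_right, inner_smul_right, inner_sub_right] at h1
    linarith
  refine ⟨c, hc0, hc, ?_, hF⟩
  have hlim : Tendsto (fun t => P.F (c t)) (𝓝[>] 0) (𝓝 (P.F x)) := by
    have h := (P.contDiff_F.continuous.continuousAt.comp hc.continuousAt).tendsto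
    simpa [Function.comp_def, hc0] using h.mono_left (nhdsWithin_le_nhds (s := Set.Ioi 0))
  have hmem := (P.polyhedral_D i).eventually_mem hd hlim
    (hF.mono fun t ht w hw => ht w (P.mem_normalSpan hi hw))
  exact hmem.mono fun t ht => Set.mem_iUnion.2 ⟨i, ht⟩

theorem eventually_le_of_feasible_curve {x : Eucl n} (hopt : P.IsLocallyOptimal x) {c : ℝ → Eucl n}
    {d : Eucl n} (hc0 : c 0 = x) (hc : HasDerivAt c d 0)
    (hfeas : ∀ᶠ t in 𝓝[>] (0 : ℝ), c t ∈ P.feasibleSet) :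
    ∀ᶠ t in 𝓝[>] (0 : ℝ), P.f x ≤ P.f (c t) := by
  have hlim : Tendsto c (𝓝[>] 0) (𝓝 x) := by
    have h := hc.continuousAt.tendsto
    rw [hc0] at h
    exact h.mono_left nhdsWithin_le_nhds
  exact (tendsto_nhdsWithin_iff.2 ⟨hlim, hfeas⟩).eventually hopt.2

theorem fderiv_f_nonneg {x : Eucl n} (hopt : P.IsLocallyOptimal x) (hlicq : P.LICQ x)
    {i : Fin r} {d : Eucl n} (hi : i ∈ P.activeIndices x)
    (hd : P.jacobian x d ∈ tangentCone (P.D i) (P.F x)) : 0 ≤ fderiv ℝ P.f x d := by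
  obtain ⟨c, hc0, hc, hfeas, -⟩ := P.exists_feasible_curve hlicq hi hd
  have hle := P.eventually_le_of_feasible_curve hopt hc0 hc hfeas
  subst hc0
  exact fderiv_apply_nonneg_of_curve (P.contDiff_f.differentiable (by norm_num) _) hc hle

theorem contDiff_lagrangian (lam : Eucl m) : ContDiff ℝ 2 fun z => P.lagrangian z lam :=
  P.contDiff_f.add (P.contDiff_F.inner ℝ contDiff_const)

theorem fderiv_lagrangian (x d : Eucl n) (lam : Eucl m) :
    fderiv ℝ (fun z => P.lagrangian z lam) x d
      = fderiv ℝ P.f x d + inner ℝ lam (P.jacobian x d) := by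
  have h1 : HasFDerivAt P.f (fderiv ℝ P.f x) x :=
    (P.contDiff_f.differentiable (by norm_num) x).hasFDerivAt
  have h2 : HasFDerivAt (fun z => inner ℝ (P.F z) lam) _ x :=
    (P.hasStrictFDerivAt_F x).hasFDerivAt.inner ℝ (hasFDerivAt_const lam x)
  have h : HasFDerivAt (fun z => P.lagrangian z lam) _ x := h1.add h2
  rw [h.fderiv]
  simp [real_inner_comm]

theorem gradient_lagrangian_eq_zero_iff (x : Eucl n) (lam : Eucl m) :
    gradient (fun z => P.lagrangian z lam) x = 0 ↔
      ∀ d, fderiv ℝ P.f x d + inner ℝ lam (P.jacobian x d) = 0 := by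
  simp only [gradient, map_eq_zero_iff _ (LinearIsometryEquiv.injective _), ← P.fderiv_lagrangian]
  exact ContinuousLinearMap.ext_iff

theorem activeIndices_nonempty {x : Eucl n} (hx : x ∈ P.feasibleSet) :
    ∃ i, i ∈ P.activeIndices x :=
  Set.mem_iUnion.1 hx

/-- A local minimizer at which MPDC-LICQ holds is strongly stationary. -/
theorem exists_mem_multipliers {x : Eucl n} (hopt : P.IsLocallyOptimal x) (hlicq : P.LICQ x) :
    ∃ lam, lam ∈ P.multipliers x := by
  obtain ⟨C, hC, hCW⟩ := exists_rightInverse_modulo_orthogonal (P.jacobian x) (P.normalSpan x)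
    fun w hw h => hlicq w h hw
  -- Stationarity tested on the range of `C` forces this choice, as `A C` is the identity modulo
  -- `Wᗮ`.
  set lam : Eucl m := -ContinuousLinearMap.adjoint C (gradient P.f x) with hlam
  have hW : lam ∈ P.normalSpan x := neg_mem (hCW _)
  have hinner : ∀ v, inner ℝ lam v = -fderiv ℝ P.f x (C v) := fun v => by
    rw [hlam, inner_neg_left, ContinuousLinearMap.adjoint_inner_left, gradient,
      InnerProductSpace.toDual_symm_apply]
  obtain ⟨i₀, hi₀⟩ := P.activeIndices_nonempty hopt.1
  have hker : ∀ d, (∀ w ∈ P.normalSpan x, inner ℝ w (P.jacobian x d) = 0) →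
      0 ≤ fderiv ℝ P.f x d := fun d hd =>
    P.fderiv_f_nonneg hopt hlicq hi₀ <| (P.polyhedral_D i₀).mem_tangentCone_of_inner_eq
      ((P.polyhedral_D i₀).zero_mem_tangentCone hi₀) fun w hw => by
        rw [hd w (P.mem_normalSpan hi₀ hw), inner_zero_right]
  refine ⟨lam, Set.mem_iInter₂.2 fun i hi => ⟨hi, fun v hv => ?_⟩,
    (P.gradient_lagrangian_eq_zero_iff x lam).2 fun d => ?_⟩
  · have h : 0 ≤ fderiv ℝ P.f x (C v) :=
      P.fderiv_f_nonneg hopt hlicq hi <| (P.polyhedral_D i).mem_tangentCone_of_inner_eq hv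
        fun w hw => hC w (P.mem_normalSpan hi hw) v
    rw [real_inner_comm, hinner]
    linarith
  -- `A` maps `d - C (A d)` into `Wᗮ`, so `hker` applies to it and to its negative, and the
  -- derivative of `f` vanishes on it.
  · have hz : ∀ w ∈ P.normalSpan x,
        inner ℝ w (P.jacobian x (d - C (P.jacobian x d))) = 0 := fun w hw => by
      rw [map_sub, inner_sub_right, hC w hw, sub_self]
    have h1 := hker _ hz
    have h2 := hker (-(d - C (P.jacobian x d))) fun w hw => by
      rw [map_neg, inner_neg_right, hz w hw, neg_zero]
    rw [hinner]
    simp only [map_neg, map_sub] at h1 h2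
    linarith

theorem multipliers_subsingleton {x : Eucl n} (hx : x ∈ P.feasibleSet) (hlicq : P.LICQ x)
    {lam mu : Eucl m} (hlam : lam ∈ P.multipliers x) (hmu : mu ∈ P.multipliers x) : lam = mu := by
  obtain ⟨i, hi⟩ := P.activeIndices_nonempty hx
  refine sub_eq_zero.1 (hlicq _ (ext_inner_right ℝ fun d => ?_) (sub_mem
    (P.mem_normalSpan hi (Set.mem_iInter₂.1 hlam.1 i hi))
    (P.mem_normalSpan hi (Set.mem_iInter₂.1 hmu.1 i hi))))
  have h1 := (P.gradient_lagrangian_eq_zero_iff x lam).1 hlam.2 d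
  have h2 := (P.gradient_lagrangian_eq_zero_iff x mu).1 hmu.2 d
  rw [ContinuousLinearMap.adjoint_inner_left, inner_sub_left, inner_zero_left]
  linarith

theorem hessian_lagrangian_nonneg {x : Eucl n} (hopt : P.IsLocallyOptimal x) (hlicq : P.LICQ x)
    {lam : Eucl m} (hlam : lam ∈ P.multipliers x) {d : Eucl n} (hd : d ∈ P.criticalCone x) :
    0 ≤ hessian (fun z => P.lagrangian z lam) x d d := by
  obtain ⟨hlin, hcrit⟩ := hd
  obtain ⟨i, hi, htan⟩ := exists_mem_tangentCone_of_iUnion P.polyhedral_D hlin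
  obtain ⟨c, hc0, hc, hfeas, haff⟩ := P.exists_feasible_curve hlicq hi htan
  have hle := P.eventually_le_of_feasible_curve hopt hc0 hc hfeas
  have hnormal := Set.mem_iInter₂.1 hlam.1 i hi
  have hstat := (P.gradient_lagrangian_eq_zero_iff x lam).1 hlam.2
  have hfd : fderiv ℝ P.f x d ≤ 0 := by
    rwa [gradient, InnerProductSpace.toDual_symm_apply] at hcrit
  -- Normality gives `≤ 0`; stationarity and criticality give `≥ 0`.
  have hzero : inner ℝ lam (P.jacobian x d) = 0 := by
    have h := hnormal.2 _ htan
    rw [real_inner_comm] at h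
    linarith [hstat d]
  subst hc0
  refine hessian_apply_nonneg_of_curve (P.contDiff_lagrangian lam) ?_ hc ?_
  · ext u
    rw [P.fderiv_lagrangian, hstat]
    rfl
  · filter_upwards [hle, haff] with t ht hat
    have h := hat lam (P.mem_normalSpan hi hnormal)
    rw [hzero, mul_zero, inner_sub_right] at h
    simp only [lagrangian, real_inner_comm lam]
    linarith

end MPDC

end Disjunctive

theorem mainTheorem2 {n m r : ℕ} (P : Disjunctive.MPDC n m r)
    (xbar : Disjunctive.Eucl n) (hopt : P.IsLocallyOptimal xbar) (hlicq : P.LICQ xbar) :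
    ∃ lambar : Disjunctive.Eucl m, P.multipliers xbar = {lambar} ∧
      ∀ d ∈ P.criticalCone xbar,
        0 ≤ Disjunctive.hessian (fun x => P.lagrangian x lambar) xbar d d := by
  obtain ⟨lam, hlam⟩ := P.exists_mem_multipliers hopt hlicq
  exact ⟨lam, Set.eq_singleton_iff_unique_mem.2
    ⟨hlam, fun mu hmu => P.multipliers_subsingleton hopt.1 hlicq hmu hlam⟩,
    fun d hd => P.hessian_lagrangian_nonneg hopt hlicq hlam hd⟩
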